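/- Let $f:\mathbb R^n\to\mathbb R$ be locally Lipschitz continuous, let $M\subset\mathbb R^n$ be nonempty and closed, and let $F:\mathbb R^n\rightrightarrows\mathbb R^m$ and $G:\mathbb R^n\times\mathbb R^m\rightrightarrows\mathbb R^s$ be set-valued mappings with closed graphs. Put $$H(z):=\bigcup_{\lambda\in F(z)}G(z,\lambda),\qquad K(z):=\{\lambda\in F(z)\mid 0\in G(z,\lambda)\},\qquad \widehat K(z,w):=\{\lambda\in F(z)\mid w\in G(z,\lambda)\},$$ $$\widehat{\mathcal H}(z,w,\lambda):=(F(z)-\lambda)\times(G(z,\lambda)-w),$$ assume that $\operatorname{gph}H$ is closed, and consider the problem of minimizing $f(z)$ subject to $0\in H(z)$ and $z\in M$. *Notions.* For a set $A$ and $\bar z\in A$, the tangent cone $\mathcal T_A(\bar z)$ consists of all limits of $(z_k-\bar z)/t_k$ with $z_k\in A$, $z_k\to\bar z$, $t_k\downarrow0$; $\widehat{\mathcal N}_A(\bar z)$ is its polar cone; and $\mathcal N_A(\bar z)$ is the set of all limits of sequences $\xi_k\in\widehat{\mathcal N}_A(z_k)$ with $z_k\in A$, $z_k\to\bar z$. Further,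 $\partial f(\bar z):=\{\xi\mid(\xi,-1)\in\mathcal N_{\operatorname{epi}f}(\bar z,f(\bar z))\}$ and $D^*\Upsilon(\bar z,\bar w)(\eta):=\{\xi\mid(\xi,-\eta)\in\mathcal N_{\operatorname{gph}\Upsilon}(\bar z,\bar w)\}$. Composition of set-valued mappings is $(S_2\circ S_1)(x):=\bigcup_{y\in S_1(x)}S_2(y)$. A mapping $\Upsilon$ is inner semicompact at $\bar z$ w.r.t. $\Omega$ if every sequence $z_k\to\bar z$ in $\Omega$ has a subsequence $z_{k_l}$ for which there is a convergent sequence with elements $w_l\in\Upsilon(z_{k_l})$; and $\Upsilon$ is metrically subregular at $(\bar z,\bar w)\in\operatorname{gph}\Upsilon$ if there are $\kappa>0$ and a neighborhood $U$ of $\bar z$ with $\operatorname{dist}(z,\Upsilon^{-1}(\bar w))\le\kappa\operatorname{dist}(\bar w,\Upsilon(z))$ for all $z\in U$, where $\operatorname{dist}(\cdot,\varnothing)=\infty$. The Jacobian is denoted by $\nabla$. A feasible point $\bar z$ is *implicitly M-stationary* if $0\in\partial f(\bar z)+D^*H(\bar z,0)(\nu)+\mathcal N_M(\bar z)$ for some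 $\nu\in\mathbb R^s$, and *explicitly M-stationary w.r.t.* $\bar\lambda\in K(\bar z)$ if there are $\mu\in\mathbb R^m$ and $\nu\in\mathbb R^s$ with $$0\in\partial f(\bar z)+D^*F(\bar z,\bar\lambda)(\mu)+\{\xi\mid(\xi,\mu)\in D^*G((\bar z,\bar\lambda),0)(\nu)\}+\mathcal N_M(\bar z).$$ **Proposition.** Let $\bar z$ be implicitly M-stationary and let $\widehat K$ be inner semicompact at $(\bar z,0)$ w.r.t. $\operatorname{dom}\widehat K$. (a) Suppose $G(z,\lambda)=g(z,\lambda)-\Theta$ for all $(z,\lambda)$, with $g:\mathbb R^n\times\mathbb R^m\to\mathbb R^s$ continuously differentiable and $\Theta\subset\mathbb R^s$ closed. Then there is $\bar\lambda\in K(\bar z)$ such that $\bar z$ is explicitly M-stationary w.r.t. $\bar\lambda$ and such that, for some $\nu\in\mathcal N_\Theta(g(\bar z,\bar\lambda))$, $$0\in\partial f(\bar z)+D^*F(\bar z,\bar\lambda)\bigl(\nabla_\lambda g(\bar z,\bar\lambda)^\top\nu\bigr)+\nabla_zg(\bar z,\bar\lambda)^\top\nu+\mathcal N_M(\bar z).$$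 (b) Suppose $G(z,\lambda)=\widetilde G(\lambda)+\tilde g(z)$ for all $(z,\lambda)$, with $\widetilde G:\mathbb R^m\rightrightarrows\mathbb R^s$ of closed graph and $\tilde g:\mathbb R^n\to\mathbb R^s$ continuously differentiable, and let $\widehat{\mathcal H}$ be metrically subregular at $((\bar z,0,\lambda),(0,0))$ for each $\lambda\in K(\bar z)$. Then there is $\bar\lambda\in K(\bar z)$ such that $\bar z$ is explicitly M-stationary w.r.t. $\bar\lambda$ and such that, for some $\nu\in\mathbb R^s$, $$0\in\partial f(\bar z)+\bigl(D^*F(\bar z,\bar\lambda)\circ D^*\widetilde G(\bar\lambda,-\tilde g(\bar z))\bigr)(\nu)+\nabla\tilde g(\bar z)^\top\nu+\mathcal N_M(\bar z).$$ -/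

import Mathlib

open Filter Topology
open scoped Pointwise

namespace ImplicitVariables

/-- The product of two Euclidean spaces with its Euclidean structure, so that normal cones to sets
of pairs (graphs, epigraphs) are formed with `⟪(a, b), (c, d)⟫ = ⟪a, c⟫ + ⟪b, d⟫`. -/
abbrev EProd (E E' : Type*) : Type _ := WithLp 2 (E × E')

/-- The pair `(x, y)` as an element of the Euclidean product. -/
abbrev pair {E E' : Type*} (x : E) (y : E') : EProd E E' := WithLp.toLp 2 (x, y)

/-! ### Set-valued mappings `Υ : E ⇉ E'`, written as functions `E → Set E'` -/

section SetValued

variable {E E' E'' : Type*}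

/-- The graph `{(z, w) | w ∈ Υ z}`. -/
def gph (Υ : E → Set E') : Set (EProd E E') := {p | p.snd ∈ Υ p.fst}

/-- The domain `{z | Υ z ≠ ∅}`. -/
def sdom (Υ : E → Set E') : Set E := {z | (Υ z).Nonempty}

/-- The inverse `Υ⁻¹ w = {z | w ∈ Υ z}`. -/
def sinv (Υ : E → Set E') : E' → Set E := fun w => {z | w ∈ Υ z}

/-- The composition `(S₂ ∘ S₁) z = ⋃ y ∈ S₁ z, S₂ y`. -/
def scomp (S₂ : E' → Set E'') (S₁ : E → Set E') : E → Set E'' := fun z => ⋃ y ∈ S₁ z, S₂ y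

/-- `Υ` is inner semicompact at `z̄` with respect to `Ω`: for each sequence `z_k → z̄` in `Ω` there
are a subsequence `z_{k_l}` and a convergent sequence `w_l` with `w_l ∈ Υ (z_{k_l})` for all `l`. -/
def InnerSemicompactAt [TopologicalSpace E] [TopologicalSpace E']
    (Υ : E → Set E') (Ω : Set E) (zbar : E) : Prop :=
  ∀ z : ℕ → E, (∀ k, z k ∈ Ω) → Tendsto z atTop (𝓝 zbar) →
    ∃ φ : ℕ → ℕ, StrictMono φ ∧ ∃ (w : ℕ → E') (wbar : E'),
      Tendsto w atTop (𝓝 wbar) ∧ ∀ l, w l ∈ Υ (z (φ l))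

/-- `Υ` is metrically subregular at the point `(z̄, w̄)` of its graph:
`dist (z, Υ⁻¹ w̄) ≤ κ dist (w̄, Υ z)` for all `z` near `z̄`. Distances are extended-valued, the
distance to the empty set being `∞`, so nothing is required at points outside the domain. -/
def MetricallySubregularAt [PseudoMetricSpace E] [PseudoMetricSpace E']
    (Υ : E → Set E') (zbar : E) (wbar : E') : Prop :=
  wbar ∈ Υ zbar ∧ ∃ κ : ℝ, 0 < κ ∧ ∃ U ∈ 𝓝 zbar, ∀ z ∈ U,
    Metric.infEDist z (sinv Υ wbar) ≤ ENNReal.ofReal κ * Metric.infEDist wbar (Υ z)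

end SetValued

/-! ### Limiting variational analysis -/

section VariationalAnalysis

variable {E E' : Type*} [NormedAddCommGroup E] [InnerProductSpace ℝ E]
  [NormedAddCommGroup E'] [InnerProductSpace ℝ E']

/-- The (Bouligand) tangent cone: all limits of `(z_k - z̄) / t_k` with `z_k ∈ A`, `z_k → z̄` and
positive `t_k → 0`. -/
def tangentCone (A : Set E) (zbar : E) : Set E :=
  {d | ∃ (z : ℕ → E) (t : ℕ → ℝ), (∀ k, z k ∈ A) ∧ (∀ k, 0 < t k) ∧
    Tendsto z atTop (𝓝 zbar) ∧ Tendsto t atTop (𝓝 0) ∧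
    Tendsto (fun k => (t k)⁻¹ • (z k - zbar)) atTop (𝓝 d)}

/-- The polar cone `{ξ | ⟪ξ, a⟫ ≤ 0 for all a ∈ A}`. -/
def polarCone (A : Set E) : Set E := {ξ | ∀ a ∈ A, inner ℝ ξ a ≤ 0}

/-- The regular (Fréchet) normal cone, the polar of the tangent cone. -/
def regularNormalCone (A : Set E) (zbar : E) : Set E := polarCone (tangentCone A zbar)

/-- The limiting (Mordukhovich) normal cone. For closed `A` it is empty at points outside `A`. -/
def normalCone (A : Set E) (zbar : E) : Set E :=
  {ξ | ∃ (z ζ : ℕ → E), (∀ k, z k ∈ A) ∧ Tendsto z atTop (𝓝 zbar) ∧ Tendsto ζ atTop (𝓝 ξ) ∧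
    ∀ k, ζ k ∈ regularNormalCone A (z k)}

/-- The epigraph `{(z, r) | r ≥ f z}`. -/
def epigraph (f : E → ℝ) : Set (EProd E ℝ) := {p | f p.fst ≤ p.snd}

/-- The limiting subdifferential `∂f(z̄) = {ξ | (ξ, -1) ∈ N_{epi f}(z̄, f z̄)}`. -/
def subdifferential (f : E → ℝ) (zbar : E) : Set E :=
  {ξ | pair ξ (-1) ∈ normalCone (epigraph f) (pair zbar (f zbar))}

/-- The limiting coderivative `D*Υ(z̄, w̄)(η) = {ξ | (ξ, -η) ∈ N_{gph Υ}(z̄, w̄)}`. -/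
def coderivative (Υ : E → Set E') (zbar : E) (wbar : E') : E' → Set E :=
  fun η => {ξ | pair ξ (-η) ∈ normalCone (gph Υ) (pair zbar wbar)}

end VariationalAnalysis

/-! ### Optimization problems with implicit variables

The problem is `f z → min` subject to `0 ∈ H z`, `z ∈ M`, where `H z = ⋃ λ ∈ F z, G (z, λ)`. In this
block `X`, `Y`, `W` are the spaces of `z`, of `λ` and of the values of `G`. -/

section Problem

variable {X Y W : Type*} [NormedAddCommGroup X] [InnerProductSpace ℝ X]
  [NormedAddCommGroup Y] [InnerProductSpace ℝ Y] [NormedAddCommGroup W] [InnerProductSpace ℝ W]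

/-- `G : X × Y ⇉ W` as a set-valued mapping of the pair `(z, λ)`. -/
def joint (G : X → Y → Set W) : EProd X Y → Set W := fun p => G p.fst p.snd

/-- `H z = ⋃ λ ∈ F z, G (z, λ)`. -/
def mapH (F : X → Set Y) (G : X → Y → Set W) : X → Set W := fun z => ⋃ y ∈ F z, G z y

/-- `K z = {λ ∈ F z | 0 ∈ G (z, λ)}`. -/
def mapK (F : X → Set Y) (G : X → Y → Set W) : X → Set Y := fun z => {y | y ∈ F z ∧ 0 ∈ G z y}

/-- `K̂ (z, w) = {λ ∈ F z | w ∈ G (z, λ)}`. -/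
def mapKhat (F : X → Set Y) (G : X → Y → Set W) : EProd X W → Set Y :=
  fun p => {y | y ∈ F p.fst ∧ p.snd ∈ G p.fst y}

/-- `Ĥ (z, w, λ) = (F z - λ) × (G (z, λ) - w)`. -/
def mapHhat (F : X → Set Y) (G : X → Y → Set W) : EProd X (EProd W Y) → Set (EProd Y W) :=
  fun p => {q | q.fst ∈ F p.fst - {p.snd.snd} ∧ q.snd ∈ G p.fst p.snd.snd - {p.snd.fst}}

/-- `z` is feasible: `0 ∈ H z` and `z ∈ M`. -/
def IsFeasible (F : X → Set Y) (G : X → Y → Set W) (M : Set X) (z : X) : Prop :=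
  0 ∈ mapH F G z ∧ z ∈ M

/-- The feasible point `z̄` is implicitly M-stationary: for some `ν`,
`0 ∈ ∂f(z̄) + D*H(z̄, 0)(ν) + N_M(z̄)`. -/
def IsImplicitlyMStationary (f : X → ℝ) (F : X → Set Y) (G : X → Y → Set W) (M : Set X)
    (zbar : X) : Prop :=
  IsFeasible F G M zbar ∧ ∃ ν : W,
    0 ∈ subdifferential f zbar + coderivative (mapH F G) zbar 0 ν + normalCone M zbar

/-- The feasible point `z̄` is explicitly M-stationary with respect to `λ̄ ∈ K z̄`: for some `μ`, `ν`,
`0 ∈ ∂f(z̄) + D*F(z̄, λ̄)(μ) + {ξ | (ξ, μ) ∈ D*G((z̄, λ̄), 0)(ν)} + N_M(z̄)`. -/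
def IsExplicitlyMStationaryWrt (f : X → ℝ) (F : X → Set Y) (G : X → Y → Set W) (M : Set X)
    (zbar : X) (lbar : Y) : Prop :=
  IsFeasible F G M zbar ∧ lbar ∈ mapK F G zbar ∧ ∃ (μ : Y) (ν : W),
    0 ∈ subdifferential f zbar + coderivative F zbar lbar μ
      + {ξ | pair ξ μ ∈ coderivative (joint G) (pair zbar lbar) 0 ν} + normalCone M zbar

end Problem

end ImplicitVariables

set_option linter.unusedSectionVars false

/-! Only the summand `ξ ∈ D*H(z̄,0)(ν)` has to be split; the terms of `f` and `M` are carried along.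
The pair `(ξ, -ν)` is a limit of regular normals to `gph H` at points `(z_k, w_k)`. Inner
semicompactness yields, along a subsequence, `λ_k ∈ K̂(z_k, w_k)` with a limit `λ̄`, and closedness
of the graphs gives `λ̄ ∈ K(z̄)` (`exists_lifted_sequence`).

In (a), smooth maps send `Θ` and `gph F` into `gph H` and hit `(z_k, w_k)`. A transposed derivative
pulls regular normals back along such a map without any qualification condition
(`mem_regularNormalCone_of_map`), and it remains to pass to the limit
(`exists_normals_of_smooth_sub_set`).

In (b), `λ` must lie in `F z` and satisfy an inclusion in `G̃ λ` at once. It is doubled into `l₁`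
and `l₂`. Subregularity of `Ĥ` bounds the distance to `gph H` by a multiple of `‖l₁ - l₂‖`, so the
constraint `l₁ = l₂` can be penalized exactly. Minimizing a smoothed penalty function gives
approximate normals to `gph F` and `gph G̃` sharing a multiplier `μ` (`exists_decoupled_normals`,
`exists_approx_normals`). Its bound does not depend on the accuracy, so the multipliers have a
cluster point (`exists_normals_of_separable`).

Explicit stationarity then follows because normals to `Θ` or `gph G̃` pull back to normals to `gph
G`. -/

namespace ImplicitVariables

/-! ### Calculus of tangent directions and regular normals under smooth maps. -/

section Transfer

variable {E E' E₁ E₂ : Type*} [NormedAddCommGroup E] [InnerProductSpace ℝ E]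
  [NormedAddCommGroup E'] [InnerProductSpace ℝ E']
  [NormedAddCommGroup E₁] [InnerProductSpace ℝ E₁]
  [NormedAddCommGroup E₂] [InnerProductSpace ℝ E₂]

/-- The pair of two continuous linear maps, with values in the Euclidean product. -/
noncomputable def pairL (A₁ : E →L[ℝ] E₁) (A₂ : E →L[ℝ] E₂) : E →L[ℝ] EProd E₁ E₂ :=
  ((WithLp.prodContinuousLinearEquiv 2 ℝ E₁ E₂).symm : E₁ × E₂ →L[ℝ] EProd E₁ E₂) ∘L (A₁.prod A₂)

theorem pairL_apply (A₁ : E →L[ℝ] E₁) (A₂ : E →L[ℝ] E₂) (v : E) :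
    pairL A₁ A₂ v = pair (A₁ v) (A₂ v) := rfl

theorem _root_.HasFDerivAt.pair {f₁ : E → E₁} {f₂ : E → E₂} {A₁ : E →L[ℝ] E₁} {A₂ : E →L[ℝ] E₂}
    {x : E} (h₁ : HasFDerivAt f₁ A₁ x) (h₂ : HasFDerivAt f₂ A₂ x) :
    HasFDerivAt (fun y => pair (f₁ y) (f₂ y)) (pairL A₁ A₂) x :=
  (((WithLp.prodContinuousLinearEquiv 2 ℝ E₁ E₂).symm : E₁ × E₂ →L[ℝ] EProd E₁ E₂).hasFDerivAt).comp
    x (h₁.prodMk h₂)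

theorem hasFDerivAt_fst' (x : EProd E₁ E₂) :
    HasFDerivAt (fun y : EProd E₁ E₂ => y.fst) (WithLp.fstL 2 ℝ E₁ E₂) x :=
  (WithLp.fstL 2 ℝ E₁ E₂).hasFDerivAt

theorem hasFDerivAt_snd' (x : EProd E₁ E₂) :
    HasFDerivAt (fun y : EProd E₁ E₂ => y.snd) (WithLp.sndL 2 ℝ E₁ E₂) x :=
  (WithLp.sndL 2 ℝ E₁ E₂).hasFDerivAt

theorem inner_pair (x : EProd E₁ E₂) (a : E₁) (b : E₂) :
    inner ℝ (pair a b) x = inner ℝ a x.fst + inner ℝ b x.snd :=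
  WithLp.prod_inner_apply _ _

theorem tendsto_pair {ι : Type*} {l : Filter ι} {a : ι → E₁} {b : ι → E₂} {a₀ : E₁} {b₀ : E₂}
    (ha : Tendsto a l (𝓝 a₀)) (hb : Tendsto b l (𝓝 b₀)) :
    Tendsto (fun i => pair (a i) (b i)) l (𝓝 (pair a₀ b₀)) :=
  ((WithLp.prod_continuous_toLp 2 E₁ E₂).tendsto (a₀, b₀)).comp (ha.prodMk_nhds hb)

theorem tendsto_fst' {ι : Type*} {l : Filter ι} {a : ι → EProd E₁ E₂} {a₀ : EProd E₁ E₂}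
    (ha : Tendsto a l (𝓝 a₀)) : Tendsto (fun i => (a i).fst) l (𝓝 a₀.fst) :=
  ((WithLp.continuous_fst 2 E₁ E₂).tendsto a₀).comp ha

theorem tendsto_snd' {ι : Type*} {l : Filter ι} {a : ι → EProd E₁ E₂} {a₀ : EProd E₁ E₂}
    (ha : Tendsto a l (𝓝 a₀)) : Tendsto (fun i => (a i).snd) l (𝓝 a₀.snd) :=
  ((WithLp.continuous_snd 2 E₁ E₂).tendsto a₀).comp ha

theorem tendsto_differenceQuotient {f : E → E'} {f' : E →L[ℝ] E'} {p d : E}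
    (h : HasFDerivAt f f' p) {z : ℕ → E} {t : ℕ → ℝ} (hz : Tendsto z atTop (𝓝 p))
    (hd : Tendsto (fun k => (t k)⁻¹ • (z k - p)) atTop (𝓝 d)) :
    Tendsto (fun k => (t k)⁻¹ • (f (z k) - f p)) atTop (𝓝 (f' d)) := by
  have h0 : Tendsto (fun k => z k - p) atTop (𝓝 0) := by
    simpa using hz.sub_const p
  have := h.hasFDerivWithinAt (s := Set.univ) |>.lim h0 (by simp) hd
  simpa using this

/-- Derivatives map tangent directions to tangent directions. -/
theorem map_mem_tangentCone {A : Set E} {B : Set E'} {f : E → E'} {f' : E →L[ℝ] E'} {p d : E}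
    (h : HasFDerivAt f f' p) (hAB : ∀ x ∈ A, f x ∈ B) (hd : d ∈ tangentCone A p) :
    f' d ∈ tangentCone B (f p) := by
  obtain ⟨z, t, hz, ht, hzp, ht0, hlim⟩ := hd
  exact ⟨fun k => f (z k), t, fun k => hAB _ (hz k), ht, h.continuousAt.tendsto.comp hzp, ht0,
    tendsto_differenceQuotient h hzp hlim⟩

/-- Regular normals are pulled back by the transpose of the derivative. -/
theorem mem_regularNormalCone_of_map {A : Set E} {B : Set E'} {f : E → E'} {f' : E →L[ℝ] E'}
    {p ξ : E} {q ζ : E'} (h : HasFDerivAt f f' p) (hq : f p = q) (hAB : ∀ x ∈ A, f x ∈ B)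
    (hζ : ζ ∈ regularNormalCone B q) (hξ : ∀ d, inner ℝ ξ d = inner ℝ ζ (f' d)) :
    ξ ∈ regularNormalCone A p := by
  subst hq
  intro d hd
  rw [hξ]
  exact hζ _ (map_mem_tangentCone h hAB hd)

/-- The derivative is nonnegative along tangent directions at a local minimizer. -/
theorem nonneg_of_isMinOn_nhds {A : Set E} {J : E → ℝ} {J' : E →L[ℝ] ℝ} {p d : E}
    (h : HasFDerivAt J J' p) (hmin : ∀ᶠ x in 𝓝 p, x ∈ A → J p ≤ J x)
    (hd : d ∈ tangentCone A p) : 0 ≤ J' d := by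
  obtain ⟨z, t, hz, ht, hzp, ht0, hlim⟩ := hd
  refine ge_of_tendsto (tendsto_differenceQuotient h hzp hlim) ?_
  filter_upwards [hzp.eventually hmin] with k hk
  exact mul_nonneg (inv_nonneg.2 (ht k).le) (sub_nonneg.2 (hk (hz k)))

/-- In finite dimensions a regular normal satisfies the `ε`-characterization. -/
theorem eventually_inner_le_of_mem_regularNormalCone [FiniteDimensional ℝ E] {A : Set E} {p ζ : E}
    (hζ : ζ ∈ regularNormalCone A p) {ε : ℝ} (hε : 0 < ε) :
    ∀ᶠ x in 𝓝 p, x ∈ A → inner ℝ ζ (x - p) ≤ ε * ‖x - p‖ := by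
  by_contra hcon
  have hfreq : ∃ᶠ x in 𝓝 p, x ∈ A ∧ ε * ‖x - p‖ < inner ℝ ζ (x - p) :=
    (Filter.not_eventually.1 hcon).mono fun x hx => by
      rwa [Classical.not_imp, not_le] at hx
  obtain ⟨x, hx, hxA⟩ := Filter.exists_seq_forall_of_frequently hfreq
  have hpos : ∀ k, 0 < ‖x k - p‖ := fun k => by
    rw [norm_pos_iff]
    intro h
    have := (hxA k).2
    simp [h] at this
  have hsphere : ∀ k, ‖x k - p‖⁻¹ • (x k - p) ∈ Metric.closedBall (0 : E) 1 := fun k => by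
    rw [mem_closedBall_zero_iff, norm_smul, norm_inv, norm_norm, inv_mul_cancel₀ (hpos k).ne']
  -- The violating points, normalized with step sizes `‖x k - p‖`, cluster at a tangent direction
  -- `d` with `⟪ζ, d⟫ ≥ ε`, against polarity.
  obtain ⟨d, -, φ, hφ, hd⟩ := tendsto_subseq_of_bounded Metric.isBounded_closedBall hsphere
  have htan : d ∈ tangentCone A p := by
    refine ⟨x ∘ φ, fun k => ‖x (φ k) - p‖, fun k => (hxA _).1, fun k => hpos _,
      hx.comp hφ.tendsto_atTop, ?_, hd⟩
    have : Tendsto (fun k => ‖x k - p‖) atTop (𝓝 0) := by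
      simpa using (hx.sub_const p).norm
    exact this.comp hφ.tendsto_atTop
  have hle := hζ d htan
  have hge : ε ≤ inner ℝ ζ d := by
    refine ge_of_tendsto ((continuous_const.inner continuous_id).tendsto d |>.comp hd)
      (Eventually.of_forall fun k => ?_)
    have h2 := (hxA (φ k)).2
    simp only [Function.comp_apply, id, inner_smul_right]
    rw [← div_eq_inv_mul, le_div_iff₀ (hpos _)]
    exact h2.le
  linarith

/-- The smooth approximation `√(δ² + ‖v‖²)` of the norm. -/
noncomputable def smoothNorm (δ : ℝ) (v : E) : ℝ := √(δ ^ 2 + ‖v‖ ^ 2)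

theorem norm_le_smoothNorm (δ : ℝ) (v : E) : ‖v‖ ≤ smoothNorm δ v :=
  Real.le_sqrt_of_sq_le (by nlinarith [sq_nonneg δ])

theorem smoothNorm_zero {δ : ℝ} (hδ : 0 < δ) : smoothNorm δ (0 : E) = δ := by
  simp [smoothNorm, Real.sqrt_sq hδ.le]

theorem smoothNorm_pos {δ : ℝ} (hδ : 0 < δ) (v : E) : 0 < smoothNorm δ v :=
  Real.sqrt_pos.2 (by positivity)

theorem continuous_smoothNorm (δ : ℝ) : Continuous (smoothNorm δ : E → ℝ) := by
  unfold smoothNorm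
  fun_prop

/-- The gradient of the smooth approximation of the norm. -/
noncomputable def smoothNormGrad (δ : ℝ) (v : E) : E := (smoothNorm δ v)⁻¹ • v

theorem norm_smoothNormGrad_le {δ : ℝ} (hδ : 0 < δ) (v : E) : ‖smoothNormGrad δ v‖ ≤ 1 := by
  rw [smoothNormGrad, norm_smul, norm_inv, Real.norm_of_nonneg (smoothNorm_pos hδ v).le,
    ← div_eq_inv_mul, div_le_one (smoothNorm_pos hδ v)]
  exact norm_le_smoothNorm δ v

theorem norm_smul_smoothNormGrad_le {δ c : ℝ} (hδ : 0 < δ) (hc : 0 ≤ c) (v : E) :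
    ‖c • smoothNormGrad δ v‖ ≤ c := by
  rw [norm_smul, Real.norm_of_nonneg hc]
  exact mul_le_of_le_one_right hc (norm_smoothNormGrad_le hδ v)

theorem hasFDerivAt_smoothNorm {δ : ℝ} (hδ : 0 < δ) {f : E' → E} {f' : E' →L[ℝ] E} {x : E'}
    (hf : HasFDerivAt f f' x) :
    HasFDerivAt (fun y => smoothNorm δ (f y)) (innerSL ℝ (smoothNormGrad δ (f x)) ∘L f') x := by
  have h := ((hf.norm_sq).const_add (δ ^ 2)).sqrt (by positivity)
  refine h.congr_fderiv ?_
  ext v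
  simp [smoothNormGrad, smoothNorm]
  ring

end Transfer

/-! ### Fuzzy multiplier rule by smooth exact penalization. -/

section Decoupling

variable {E₁ E₂ Y : Type*} [NormedAddCommGroup E₁] [InnerProductSpace ℝ E₁]
  [NormedAddCommGroup E₂] [InnerProductSpace ℝ E₂] [NormedAddCommGroup Y] [InnerProductSpace ℝ Y]

/-- A fuzzy multiplier rule for the coupling constraint `A₁ a = A₂ b`, penalized exactly, over
the product of two closed sets. -/
theorem exists_decoupled_normals [FiniteDimensional ℝ E₁] [FiniteDimensional ℝ E₂]
    {S₁ : Set E₁} {S₂ : Set E₂} (hS₁ : IsClosed S₁) (hS₂ : IsClosed S₂)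
    (A₁ : E₁ →L[ℝ] Y) (A₂ : E₂ →L[ℝ] Y) {ψ₁ : E₁ → ℝ} {ψ₂ : E₂ → ℝ} {g₁ : E₁ → E₁} {g₂ : E₂ → E₂}
    (h₁ : ∀ a, HasFDerivAt ψ₁ (innerSL ℝ (g₁ a)) a) (h₂ : ∀ b, HasFDerivAt ψ₂ (innerSL ℝ (g₂ b)) b)
    {a₀ : E₁} {b₀ : E₂} (ha₀ : a₀ ∈ S₁) (hb₀ : b₀ ∈ S₂) (hAB : A₁ a₀ = A₂ b₀)
    {ε L ρ : ℝ} (hε : 0 < ε) (hL : 0 ≤ L) (hρ : 0 < ρ)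
    (hle : ∀ᶠ x : E₁ × E₂ in 𝓝 (a₀, b₀), x.1 ∈ S₁ → x.2 ∈ S₂ →
      ψ₁ x.1 - ψ₁ a₀ + (ψ₂ x.2 - ψ₂ b₀) ≤
        ε * (‖x.1 - a₀‖ + ‖x.2 - b₀‖) + L * ‖A₁ x.1 - A₂ x.2‖) :
    ∃ a ∈ S₁, ∃ b ∈ S₂, ‖a - a₀‖ ≤ ρ ∧ ‖b - b₀‖ ≤ ρ ∧ ∃ (μ : Y) (e₁ : E₁) (e₂ : E₂),
      ‖μ‖ ≤ L ∧ ‖e₁‖ ≤ 2 * ε ∧ ‖e₂‖ ≤ 2 * ε ∧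
      (∀ d ∈ tangentCone S₁ a, inner ℝ (g₁ a) d - inner ℝ μ (A₁ d) - inner ℝ e₁ d ≤ 0) ∧
      (∀ d ∈ tangentCone S₂ b, inner ℝ (g₂ b) d + inner ℝ μ (A₂ d) - inner ℝ e₂ d ≤ 0) := by
  obtain ⟨r₀, hr₀, hball⟩ := Metric.nhds_basis_closedBall.eventually_iff.1 hle
  set r := min r₀ ρ with hr
  have hrpos : 0 < r := lt_min hr₀ hρ
  -- At `(a₀, b₀)` all three smoothed norms equal `δ`, so the penalty there is `(4ε + L)δ`; this
  -- choice makes it `εr/2`.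
  set δ := ε * r / (2 * (4 * ε + L)) with hδdef
  have hδ : 0 < δ := by positivity
  have hδε : (4 * ε + L) * δ = ε * r / 2 := by
    rw [hδdef]; field_simp
  -- The weight `2ε` is twice that in `hle`; the surplus `ε` keeps the minimizer close to `(a₀,
  -- b₀)`.
  set J : E₁ × E₂ → ℝ := fun x => 2 * ε * (smoothNorm δ (x.1 - a₀) + smoothNorm δ (x.2 - b₀)) +
    L * smoothNorm δ (A₁ x.1 - A₂ x.2) - (ψ₁ x.1 + ψ₂ x.2) with hJ
  have hψ₁ : Continuous ψ₁ := continuous_iff_continuousAt.2 fun a => (h₁ a).continuousAt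
  have hψ₂ : Continuous ψ₂ := continuous_iff_continuousAt.2 fun b => (h₂ b).continuousAt
  have hJc : Continuous J := by
    have e1 := (continuous_smoothNorm (E := E₁) δ).comp (continuous_fst.sub continuous_const :
      Continuous fun x : E₁ × E₂ => x.1 - a₀)
    have e2 := (continuous_smoothNorm (E := E₂) δ).comp (continuous_snd.sub continuous_const :
      Continuous fun x : E₁ × E₂ => x.2 - b₀)
    have e3 := (continuous_smoothNorm (E := Y) δ).comp (((A₁.continuous.comp continuous_fst).sub
      (A₂.continuous.comp continuous_snd)) : Continuous fun x : E₁ × E₂ => A₁ x.1 - A₂ x.2)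
    exact ((continuous_const.mul (e1.add e2)).add (continuous_const.mul e3)).sub
      ((hψ₁.comp continuous_fst).add (hψ₂.comp continuous_snd))
  have hKc : IsCompact (Metric.closedBall (a₀, b₀) r ∩ S₁ ×ˢ S₂) :=
    (isCompact_closedBall _ _).inter_right (hS₁.prod hS₂)
  have hx₀K : (a₀, b₀) ∈ Metric.closedBall (a₀, b₀) r ∩ S₁ ×ˢ S₂ :=
    ⟨Metric.mem_closedBall_self hrpos.le, ha₀, hb₀⟩
  obtain ⟨⟨a, b⟩, ⟨hxr, ha, hb⟩, hmin⟩ := hKc.exists_isMinOn ⟨_, hx₀K⟩ hJc.continuousOn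
  have hJ₀ : J (a₀, b₀) = ε * r / 2 - (ψ₁ a₀ + ψ₂ b₀) := by
    simp only [hJ, sub_self, hAB, smoothNorm_zero hδ]
    linarith
  have hJx : J (a, b) ≤ J (a₀, b₀) := hmin hx₀K
  have hlex := hball (Metric.closedBall_subset_closedBall (min_le_left _ _) hxr) ha hb
  -- Comparing `J (a, b) ≤ J (a₀, b₀)` with `hle` leaves a sum of at most `r/2`. The minimizer is
  -- thus interior to the ball, hence a local minimizer over `S₁ × S₂`.
  have hsum : ‖a - a₀‖ + ‖b - b₀‖ < r := by
    rw [hJ₀] at hJx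
    simp only [hJ] at hJx
    dsimp only at hlex
    have n1 := norm_le_smoothNorm δ (a - a₀)
    have n2 := norm_le_smoothNorm δ (b - b₀)
    have n3 := mul_le_mul_of_nonneg_left (norm_le_smoothNorm δ (A₁ a - A₂ b)) hL
    have n4 : 2 * ε * (‖a - a₀‖ + ‖b - b₀‖) ≤
        2 * ε * (smoothNorm δ (a - a₀) + smoothNorm δ (b - b₀)) := by gcongr
    have : ε * (‖a - a₀‖ + ‖b - b₀‖) ≤ ε * (r / 2) := by linarith
    linarith [le_of_mul_le_mul_left this hε]
  have hloc : ∀ᶠ y in 𝓝 (a, b), y.1 ∈ S₁ → y.2 ∈ S₂ → J (a, b) ≤ J y := by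
    have hmem : Metric.closedBall (a₀, b₀) r ∈ 𝓝 (a, b) := by
      refine Metric.closedBall_mem_nhds_of_mem (Metric.mem_ball.2 ?_)
      rw [Prod.dist_eq, dist_eq_norm, dist_eq_norm]
      exact max_lt (by linarith [norm_nonneg (b - b₀)]) (by linarith [norm_nonneg (a - a₀)])
    filter_upwards [hmem] with y hy hy1 hy2
    exact hmin ⟨hy, hy1, hy2⟩
  have hrρ : r ≤ ρ := min_le_right _ _
  -- The multiplier is the gradient of the smoothed coupling penalty. It enters both partial
  -- optimality conditions, with opposite signs.
  set μ := L • smoothNormGrad δ (A₁ a - A₂ b) with hμ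
  set e₁ := (2 * ε) • smoothNormGrad δ (a - a₀) with he₁
  set e₂ := (2 * ε) • smoothNormGrad δ (b - b₀) with he₂
  refine ⟨a, ha, b, hb, by linarith [norm_nonneg (b - b₀)], by linarith [norm_nonneg (a - a₀)],
    μ, e₁, e₂, norm_smul_smoothNormGrad_le hδ hL _,
    norm_smul_smoothNormGrad_le hδ (by positivity) _,
    norm_smul_smoothNormGrad_le hδ (by positivity) _, ?_, ?_⟩
  · intro d hd
    have hder : HasFDerivAt (fun a' => J (a', b)) _ a :=
      (((((hasFDerivAt_smoothNorm hδ ((hasFDerivAt_id a).sub_const a₀)).add_const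
        (smoothNorm δ (b - b₀))).const_mul (2 * ε)).add
        ((hasFDerivAt_smoothNorm hδ ((A₁.hasFDerivAt (x := a)).sub_const (A₂ b))).const_mul L)).sub
        ((h₁ a).add_const (ψ₂ b)))
    have hev : ∀ᶠ a' in 𝓝 a, a' ∈ S₁ → J (a, b) ≤ J (a', b) := by
      have : Tendsto (fun a' : E₁ => (a', b)) (𝓝 a) (𝓝 (a, b)) :=
        (Continuous.prodMk_left b).tendsto a
      exact (this.eventually hloc).mono fun a' h ha' => h ha' hb
    have := nonneg_of_isMinOn_nhds hder hev hd
    simp at this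
    simp [hμ, he₁, inner_smul_left]
    linarith
  · intro d hd
    have hder : HasFDerivAt (fun b' => J (a, b')) _ b :=
      (((((hasFDerivAt_smoothNorm hδ ((hasFDerivAt_id b).sub_const b₀)).const_add
        (smoothNorm δ (a - a₀))).const_mul (2 * ε)).add
        ((hasFDerivAt_smoothNorm hδ ((A₂.hasFDerivAt (x := b)).const_sub (A₁ a))).const_mul L)).sub
        ((h₂ b).const_add (ψ₁ a)))
    have hev : ∀ᶠ b' in 𝓝 b, b' ∈ S₂ → J (a, b) ≤ J (a, b') := by
      have : Tendsto (fun b' : E₂ => (a, b')) (𝓝 b) (𝓝 (a, b)) :=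
        (Continuous.prodMk_right a).tendsto b
      exact (this.eventually hloc).mono fun b' h hb' => h ha hb'
    have := nonneg_of_isMinOn_nhds hder hev hd
    simp at this
    simp [hμ, he₂, inner_smul_left]
    linarith

end Decoupling

/-! ### Lifting normals of `gph H` to the implicit variable. -/

section Problem

variable {X Y W : Type*} [NormedAddCommGroup X] [InnerProductSpace ℝ X]
  [NormedAddCommGroup Y] [InnerProductSpace ℝ Y] [NormedAddCommGroup W] [InnerProductSpace ℝ W]
  {F : X → Set Y} {G : X → Y → Set W}

theorem mem_gph_mapH {p : EProd X W} : p ∈ gph (mapH F G) ↔ ∃ l ∈ F p.fst, p.snd ∈ G p.fst l := by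
  simp [gph, mapH]

/-- Inner semicompactness of `K̂` lifts a limiting normal to `gph H` to a convergent sequence of
implicit variables along the approximating regular normals. -/
theorem exists_lifted_sequence (hF : IsClosed (gph F)) (hG : IsClosed (gph (joint G)))
    {zbar : X} (hK : InnerSemicompactAt (mapKhat F G) (sdom (mapKhat F G)) (pair zbar 0))
    {ζ : EProd X W} (hζ : ζ ∈ normalCone (gph (mapH F G)) (pair zbar 0)) :
    ∃ lbar ∈ mapK F G zbar, ∃ (p η : ℕ → EProd X W) (l : ℕ → Y),
      (∀ k, l k ∈ F (p k).fst ∧ (p k).snd ∈ G (p k).fst (l k)) ∧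
      Tendsto p atTop (𝓝 (pair zbar 0)) ∧ Tendsto η atTop (𝓝 ζ) ∧ Tendsto l atTop (𝓝 lbar) ∧
      ∀ k, η k ∈ regularNormalCone (gph (mapH F G)) (p k) := by
  obtain ⟨p, η, hp, hplim, hηlim, hη⟩ := hζ
  obtain ⟨φ, hφ, l, lbar, hl, hmem⟩ := hK p
    (fun k => by obtain ⟨l, h1, h2⟩ := mem_gph_mapH.1 (hp k); exact ⟨l, h1, h2⟩) hplim
  have hpφ := hplim.comp hφ.tendsto_atTop
  refine ⟨lbar, ⟨?_, ?_⟩, p ∘ φ, η ∘ φ, l, hmem, hpφ, hηlim.comp hφ.tendsto_atTop, hl,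
    fun k => hη _⟩
  · exact hF.mem_of_tendsto (tendsto_pair (tendsto_fst' hpφ) hl)
      (Eventually.of_forall fun k => (hmem k).1)
  · exact hG.mem_of_tendsto (tendsto_pair (tendsto_pair (tendsto_fst' hpφ) hl) (tendsto_snd' hpφ))
      (Eventually.of_forall fun k => (hmem k).2)

theorem fderiv_partial_left {g : X → Y → W} {D : X × Y →L[ℝ] W} {z : X} {l : Y}
    (h : HasFDerivAt (fun p : X × Y => g p.1 p.2) D (z, l)) :
    fderiv ℝ (fun z => g z l) z = D ∘L .inl ℝ X Y :=
  (HasFDerivAt.comp (g := fun p : X × Y => g p.1 p.2) (f := fun z => (z, l)) z h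
    (hasFDerivAt_prodMk_left z l)).fderiv

theorem fderiv_partial_right {g : X → Y → W} {D : X × Y →L[ℝ] W} {z : X} {l : Y}
    (h : HasFDerivAt (fun p : X × Y => g p.1 p.2) D (z, l)) :
    fderiv ℝ (fun l => g z l) l = D ∘L .inr ℝ X Y :=
  (HasFDerivAt.comp (g := fun p : X × Y => g p.1 p.2) (f := fun l => (z, l)) l h
    (hasFDerivAt_prodMk_right z l)).fderiv

/-! ### Case (a): `G = g - Θ`. -/

section Smooth

variable [CompleteSpace X] [CompleteSpace Y] [CompleteSpace W]

theorem tendsto_clm_apply {ι : Type*} {u : Filter ι} {A : ι → X →L[ℝ] W} {A₀ : X →L[ℝ] W}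
    {v : ι → X} {v₀ : X} (hA : Tendsto A u (𝓝 A₀)) (hv : Tendsto v u (𝓝 v₀)) :
    Tendsto (fun i => A i (v i)) u (𝓝 (A₀ v₀)) := by
  have hc : Continuous fun q : (X →L[ℝ] W) × X => q.1 q.2 :=
    continuous_fst.clm_apply continuous_snd
  exact (hc.tendsto (A₀, v₀)).comp (hA.prodMk_nhds hv)

theorem tendsto_adjoint {ι : Type*} {u : Filter ι} {A : ι → X →L[ℝ] W} {A₀ : X →L[ℝ] W}
    (hA : Tendsto A u (𝓝 A₀)) :
    Tendsto (fun i => ContinuousLinearMap.adjoint (A i)) u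
      (𝓝 (ContinuousLinearMap.adjoint A₀)) :=
  (ContinuousLinearMap.adjoint.continuous.tendsto A₀).comp hA

/-- Each regular normal of `gph H` is pulled back twice, once with `(z, λ)` frozen and once with the
element of `Θ` frozen. Continuity of the derivative of `g` and of the adjoint carries both relations
to the limit. -/
theorem exists_normals_of_smooth_sub_set (hF : IsClosed (gph F)) (hG : IsClosed (gph (joint G)))
    {zbar : X} (hK : InnerSemicompactAt (mapKhat F G) (sdom (mapKhat F G)) (pair zbar 0))
    {g : X → Y → W} {Θ : Set W} (hg : ContDiff ℝ 1 (fun p : X × Y => g p.1 p.2))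
    (hGg : ∀ z l, G z l = {g z l} - Θ) {ξ : X} {ν : W}
    (hξ : ξ ∈ coderivative (mapH F G) zbar 0 ν) :
    ∃ lbar ∈ mapK F G zbar, ν ∈ normalCone Θ (g zbar lbar) ∧
      ξ - ContinuousLinearMap.adjoint (fderiv ℝ (fun z => g z lbar) zbar) ν ∈
        coderivative F zbar lbar
          (ContinuousLinearMap.adjoint (fderiv ℝ (fun l => g zbar l) lbar) ν) := by
  obtain ⟨lbar, hlbar, p, η, l, hmem, hp, hη, hl, hreg⟩ := exists_lifted_sequence hF hG hK hξ
  have hz : Tendsto (fun k => (p k).fst) atTop (𝓝 zbar) := tendsto_fst' hp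
  have hw : Tendsto (fun k => (p k).snd) atTop (𝓝 0) := tendsto_snd' hp
  have hη₁ : Tendsto (fun k => (η k).fst) atTop (𝓝 ξ) := tendsto_fst' hη
  have hη₂ : Tendsto (fun k => (η k).snd) atTop (𝓝 (-ν)) := tendsto_snd' hη
  set D : X × Y → (X × Y →L[ℝ] W) := fderiv ℝ (fun p : X × Y => g p.1 p.2) with hD
  have hder : ∀ q : X × Y, HasFDerivAt (fun p : X × Y => g p.1 p.2) (D q) q := fun q =>
    (hg.differentiable one_ne_zero q).hasFDerivAt
  have hDc : Continuous D := hg.continuous_fderiv one_ne_zero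
  have hD₁ : fderiv ℝ (fun z => g z lbar) zbar = D (zbar, lbar) ∘L .inl ℝ X Y :=
    fderiv_partial_left (hder (zbar, lbar))
  have hD₂ : fderiv ℝ (fun l => g zbar l) lbar = D (zbar, lbar) ∘L .inr ℝ X Y :=
    fderiv_partial_right (hder (zbar, lbar))
  have hzl : Tendsto (fun k => ((p k).fst, l k)) atTop (𝓝 (zbar, lbar)) := hz.prodMk_nhds hl
  have hgc := (hg.continuous.tendsto (zbar, lbar)).comp hzl
  have hDlim := (hDc.tendsto (zbar, lbar)).comp hzl
  have hA₁ : Tendsto (fun k => ContinuousLinearMap.adjoint (D ((p k).fst, l k) ∘L .inl ℝ X Y)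
      (η k).snd) atTop
      (𝓝 (ContinuousLinearMap.adjoint (D (zbar, lbar) ∘L .inl ℝ X Y) (-ν))) :=
    tendsto_clm_apply (tendsto_adjoint (((continuous_id.clm_comp
      continuous_const).tendsto (D (zbar, lbar))).comp hDlim)) hη₂
  have hA₂ : Tendsto (fun k => ContinuousLinearMap.adjoint (D ((p k).fst, l k) ∘L .inr ℝ X Y)
      (η k).snd) atTop
      (𝓝 (ContinuousLinearMap.adjoint (D (zbar, lbar) ∘L .inr ℝ X Y) (-ν))) :=
    tendsto_clm_apply (tendsto_adjoint (((continuous_id.clm_comp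
      continuous_const).tendsto (D (zbar, lbar))).comp hDlim)) hη₂
  have hθ : ∀ k, g (p k).fst (l k) - (p k).snd ∈ Θ := fun k => by
    have h := (hmem k).2
    rw [hGg, Set.singleton_sub] at h
    obtain ⟨θ, hθ, he⟩ := h
    rw [← he]
    simpa using hθ
  refine ⟨lbar, hlbar, ?_, ?_⟩
  · refine ⟨fun k => g (p k).fst (l k) - (p k).snd, fun k => -(η k).snd, hθ, ?_, ?_, fun k => ?_⟩
    · simpa using hgc.sub hw
    · simpa using hη₂.neg
    -- The map `θ ↦ (z_k, g(z_k, λ_k) - θ)` sends `Θ` into `gph H`, because `λ_k ∈ F z_k`.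
    · refine mem_regularNormalCone_of_map (B := gph (mapH F G)) (ζ := η k) (q := p k)
        ((hasFDerivAt_const (p k).fst _).pair
          ((hasFDerivAt_id _).const_sub (g (p k).fst (l k)))) ?_ ?_ (hreg k) ?_
      · simp only [id, sub_sub_cancel]
        rfl
      · intro θ hθ
        refine mem_gph_mapH.2 ⟨l k, (hmem k).1, ?_⟩
        rw [hGg, Set.singleton_sub]
        exact ⟨θ, hθ, rfl⟩
      · intro d
        simp [pairL_apply, WithLp.prod_inner_apply]
  · rw [hD₁, hD₂]
    refine ⟨fun k => pair (p k).fst (l k), fun k => pair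
      ((η k).fst + ContinuousLinearMap.adjoint (D ((p k).fst, l k) ∘L .inl ℝ X Y) (η k).snd)
      (ContinuousLinearMap.adjoint (D ((p k).fst, l k) ∘L .inr ℝ X Y) (η k).snd),
      fun k => (hmem k).1, tendsto_pair hz hl, ?_, fun k => ?_⟩
    · refine tendsto_pair ?_ ?_
      · simpa [sub_eq_add_neg] using hη₁.add hA₁
      · simpa using hA₂
    · have hc : HasFDerivAt (fun q : EProd X Y => g q.fst q.snd)
          (D ((p k).fst, l k) ∘L (WithLp.fstL 2 ℝ X Y).prod (WithLp.sndL 2 ℝ X Y))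
          (pair (p k).fst (l k)) :=
        HasFDerivAt.comp (g := fun p : X × Y => g p.1 p.2)
          (f := fun q : EProd X Y => (q.fst, q.snd)) (pair (p k).fst (l k)) (hder ((p k).fst, l k))
          ((hasFDerivAt_fst' _).prodMk (hasFDerivAt_snd' _))
      -- The map `(z, λ) ↦ (z, g(z, λ) - θ_k)` with `θ_k = g(z_k, λ_k) - w_k` sends `gph F` into
      -- `gph H`.
      refine mem_regularNormalCone_of_map (B := gph (mapH F G)) (ζ := η k) (q := p k)
        ((hasFDerivAt_fst' _).pair (hc.sub_const (g (p k).fst (l k) - (p k).snd))) ?_ ?_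
        (hreg k) ?_
      · simp only [WithLp.toLp_fst, WithLp.toLp_snd, sub_sub_cancel]
        rfl
      · intro q hq
        refine mem_gph_mapH.2 ⟨q.snd, hq, ?_⟩
        rw [hGg, Set.singleton_sub]
        exact ⟨_, hθ k, rfl⟩
      · intro d
        have : D ((p k).fst, l k) (d.fst, d.snd) =
            D ((p k).fst, l k) (d.fst, 0) + D ((p k).fst, l k) (0, d.snd) := by
          rw [← map_add]; simp
        simp only [pairL_apply, WithLp.prod_inner_apply, ContinuousLinearMap.comp_apply,
          ContinuousLinearMap.prod_apply]
        simp [ContinuousLinearMap.adjoint_inner_left, inner_add_left, this, inner_add_right]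
        ring

/-- Normals to `Θ` yield elements of the coderivative of `(z, λ) ↦ g (z, λ) - Θ`. -/
theorem mem_coderivative_joint_of_smooth_sub_set {g : X → Y → W} {Θ : Set W}
    (hg : ContDiff ℝ 1 (fun p : X × Y => g p.1 p.2))
    (hGg : ∀ z l, G z l = {g z l} - Θ) {zbar : X} {lbar : Y} {ν : W}
    (hν : ν ∈ normalCone Θ (g zbar lbar)) :
    pair (ContinuousLinearMap.adjoint (fderiv ℝ (fun z => g z lbar) zbar) ν)
      (ContinuousLinearMap.adjoint (fderiv ℝ (fun l => g zbar l) lbar) ν) ∈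
        coderivative (joint G) (pair zbar lbar) 0 ν := by
  obtain ⟨θ, η, hθ, hθlim, hη, hreg⟩ := hν
  set D : X × Y → (X × Y →L[ℝ] W) := fderiv ℝ (fun p : X × Y => g p.1 p.2) with hD
  have hder : ∀ q : X × Y, HasFDerivAt (fun p : X × Y => g p.1 p.2) (D q) q := fun q =>
    (hg.differentiable one_ne_zero q).hasFDerivAt
  have hD₁ : fderiv ℝ (fun z => g z lbar) zbar = D (zbar, lbar) ∘L .inl ℝ X Y :=
    fderiv_partial_left (hder (zbar, lbar))
  have hD₂ : fderiv ℝ (fun l => g zbar l) lbar = D (zbar, lbar) ∘L .inr ℝ X Y :=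
    fderiv_partial_right (hder (zbar, lbar))
  rw [hD₁, hD₂]
  refine ⟨fun k => pair (pair zbar lbar) (g zbar lbar - θ k), fun k => pair (pair
    (ContinuousLinearMap.adjoint (D (zbar, lbar) ∘L .inl ℝ X Y) (η k))
    (ContinuousLinearMap.adjoint (D (zbar, lbar) ∘L .inr ℝ X Y) (η k))) (-η k),
    fun k => ?_, ?_, ?_, fun k => ?_⟩
  · change _ ∈ G zbar lbar
    rw [hGg, Set.singleton_sub]
    exact ⟨_, hθ k, rfl⟩
  · refine tendsto_pair tendsto_const_nhds ?_
    simpa using hθlim.const_sub (g zbar lbar)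
  · exact tendsto_pair (tendsto_pair (((ContinuousLinearMap.continuous _).tendsto _).comp hη)
      (((ContinuousLinearMap.continuous _).tendsto _).comp hη)) hη.neg
  · set q₀ : EProd (EProd X Y) W := pair (pair zbar lbar) (g zbar lbar - θ k)
    have hc : HasFDerivAt (fun q : EProd (EProd X Y) W => g q.fst.fst q.fst.snd)
        (D (zbar, lbar) ∘L (((WithLp.fstL 2 ℝ X Y) ∘L WithLp.fstL 2 ℝ (EProd X Y) W).prod
          ((WithLp.sndL 2 ℝ X Y) ∘L WithLp.fstL 2 ℝ (EProd X Y) W))) q₀ :=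
      HasFDerivAt.comp (g := fun p : X × Y => g p.1 p.2)
        (f := fun q : EProd (EProd X Y) W => (q.fst.fst, q.fst.snd)) q₀ (hder (zbar, lbar))
        ((((WithLp.fstL 2 ℝ X Y) ∘L WithLp.fstL 2 ℝ (EProd X Y) W).prod
          ((WithLp.sndL 2 ℝ X Y) ∘L WithLp.fstL 2 ℝ (EProd X Y) W)).hasFDerivAt)
    -- The map `((z, λ), w) ↦ g(z, λ) - w` sends `gph G` into `Θ`. Only `w` varies along the
    -- sequence of base points, so the derivative of `g` stays fixed.
    refine mem_regularNormalCone_of_map (B := Θ) (ζ := η k) (q := θ k)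
      (hc.fun_sub (hasFDerivAt_snd' q₀)) ?_ ?_ (hreg k) ?_
    · simp
    · intro q hq
      change q.snd ∈ G q.fst.fst q.fst.snd at hq
      rw [hGg, Set.singleton_sub] at hq
      obtain ⟨θ', hθ', he⟩ := hq
      simp only at he
      rw [← he]
      simpa using hθ'
    · intro d
      have : D (zbar, lbar) (d.fst.fst, d.fst.snd) =
          D (zbar, lbar) (d.fst.fst, 0) + D (zbar, lbar) (0, d.fst.snd) := by
        rw [← map_add]; simp
      simp only [WithLp.prod_inner_apply, ContinuousLinearMap.comp_apply,
        ContinuousLinearMap.prod_apply, sub_apply]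
      simp [ContinuousLinearMap.adjoint_inner_left, this, inner_add_right, inner_sub_right]
      ring

end Smooth

end Problem

/-! ### Case (b): `G = G̃ + g̃` under metric subregularity. -/

section Separable

variable {X Y W : Type*} [NormedAddCommGroup X] [InnerProductSpace ℝ X]
  [NormedAddCommGroup Y] [InnerProductSpace ℝ Y] [NormedAddCommGroup W] [InnerProductSpace ℝ W]
  {F : X → Set Y} {G : X → Y → Set W} {Gt : Y → Set W} {gt : X → W}

theorem norm_pair_le_norm_pair_pair (x : X) (w : W) (y : Y) :
    ‖pair x w‖ ≤ ‖pair x (pair w y)‖ := by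
  refine abs_le_of_sq_le_sq' ?_ (norm_nonneg _) |>.2
  simp only [WithLp.prod_norm_sq_eq_of_L2]
  change ‖x‖ ^ 2 + ‖w‖ ^ 2 ≤ ‖x‖ ^ 2 + (‖w‖ ^ 2 + ‖y‖ ^ 2)
  nlinarith [sq_nonneg ‖y‖]

theorem mem_sinv_mapHhat_zero {z : X} {w : W} {l : Y} :
    pair z (pair w l) ∈ sinv (mapHhat F G) (pair 0 0) ↔ l ∈ F z ∧ w ∈ G z l := by
  simp [sinv, mapHhat, sub_eq_zero]

/-- Metric subregularity of `Ĥ` bounds the distance to `gph H` by the mismatch of the two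
implicit variables. -/
theorem MetricallySubregularAt.exists_error_bound {x₀ : EProd X (EProd W Y)}
    (h : MetricallySubregularAt (mapHhat F G) x₀ (pair 0 0)) :
    ∃ κ : ℝ, 0 < κ ∧ ∃ U ∈ 𝓝 x₀, ∀ z w l₁ l₂, pair z (pair w l₂) ∈ U → l₁ ∈ F z → w ∈ G z l₂ →
      ∃ p ∈ gph (mapH F G), ‖p - pair z w‖ ≤ κ * ‖l₁ - l₂‖ := by
  obtain ⟨-, κ, hκ, U, hU, hsub⟩ := h
  -- The infimal distance need not be attained; doubling `κ` makes the bound strict when `l₁ ≠ l₂`,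
  -- which yields an actual nearby point.
  refine ⟨2 * κ, by positivity, U, hU, fun z w l₁ l₂ hxU hl₁ hw => ?_⟩
  by_cases hl : l₁ = l₂
  · subst hl
    exact ⟨pair z w, mem_gph_mapH.2 ⟨l₁, hl₁, hw⟩, by simp⟩
  have hpos : 0 < ‖l₁ - l₂‖ := norm_pos_iff.2 (sub_ne_zero.2 hl)
  have hmem : (pair (l₁ - l₂) 0 : EProd Y W) ∈ mapHhat F G (pair z (pair w l₂)) := by
    simpa [mapHhat, hl₁] using ⟨w, hw, sub_self w⟩
  have hdist : Metric.infEDist (pair 0 0 : EProd Y W) (mapHhat F G (pair z (pair w l₂))) ≤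
      ENNReal.ofReal ‖l₁ - l₂‖ := by
    refine (Metric.infEDist_le_edist_of_mem hmem).trans (le_of_eq ?_)
    rw [edist_comm, WithLp.edist_toLp_fst, edist_dist, dist_zero_right]
  have hlt : Metric.infEDist (pair z (pair w l₂)) (sinv (mapHhat F G) (pair 0 0)) <
      ENNReal.ofReal (2 * κ * ‖l₁ - l₂‖) := by
    refine ((hsub _ hxU).trans (mul_le_mul_right hdist _)).trans_lt ?_
    rw [← ENNReal.ofReal_mul hκ.le, ENNReal.ofReal_lt_ofReal_iff (by positivity)]
    nlinarith [mul_pos hκ hpos]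
  obtain ⟨y, hy, hyd⟩ := Metric.infEDist_lt_iff.1 hlt
  obtain ⟨h₁, h₂⟩ := mem_sinv_mapHhat_zero (z := y.fst) (w := y.snd.fst) (l := y.snd.snd).1 hy
  refine ⟨pair y.fst y.snd.fst, mem_gph_mapH.2 ⟨_, h₁, h₂⟩, ?_⟩
  rw [edist_comm, edist_dist, ENNReal.ofReal_lt_ofReal_iff (by positivity), dist_eq_norm] at hyd
  exact (norm_pair_le_norm_pair_pair (y.fst - z) (y.snd.fst - w) (y.snd.snd - l₂)).trans hyd.le

variable [FiniteDimensional ℝ X] [FiniteDimensional ℝ Y] [FiniteDimensional ℝ W]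

/-- Regular normals to `gph H` decouple approximately into regular normals to `gph F` and to the
graph of `λ ↦ G̃ λ`, with a multiplier bounded in terms of the error bound constant. -/
theorem exists_approx_normals (hF : IsClosed (gph F)) (hGt : IsClosed (gph Gt))
    (hgt : ContDiff ℝ 1 gt) (hGg : ∀ z l, G z l = Gt l + {gt z})
    {κ : ℝ} (hκ : 0 < κ) {p₀ ζ : EProd X W} {l₀ : Y} {U : Set (EProd X (EProd W Y))}
    (hU : U ∈ 𝓝 (pair p₀.fst (pair p₀.snd l₀)))
    (hbound : ∀ z w l₁ l₂, pair z (pair w l₂) ∈ U → l₁ ∈ F z → w ∈ G z l₂ →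
      ∃ p ∈ gph (mapH F G), ‖p - pair z w‖ ≤ κ * ‖l₁ - l₂‖)
    (hl₀ : l₀ ∈ F p₀.fst) (hp₀ : p₀.snd ∈ G p₀.fst l₀)
    (hζ : ζ ∈ regularNormalCone (gph (mapH F G)) p₀) {ε ρ : ℝ} (hε : 0 < ε) (hρ : 0 < ρ) :
    ∃ a ∈ gph F, ∃ b ∈ gph Gt, ‖a - pair p₀.fst l₀‖ ≤ ρ ∧
      ‖b - pair l₀ (p₀.snd - gt p₀.fst)‖ ≤ ρ ∧
      ∃ (μ : Y) (e₁ : EProd X Y) (e₂ : EProd Y W),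
        ‖μ‖ ≤ (1 + ‖ζ‖) * κ ∧ ‖e₁‖ ≤ ε ∧ ‖e₂‖ ≤ ε ∧
        pair (ζ.fst + ContinuousLinearMap.adjoint (fderiv ℝ gt a.fst) ζ.snd) (-μ) - e₁ ∈
          regularNormalCone (gph F) a ∧
        pair μ ζ.snd - e₂ ∈ regularNormalCone (gph Gt) b := by
  have hder : ∀ z, HasFDerivAt gt (fderiv ℝ gt z) z := fun z =>
    (hgt.differentiable one_ne_zero z).hasFDerivAt
  have hGmem : ∀ {z l w}, w ∈ G z l ↔ w - gt z ∈ Gt l := fun {z l w} => by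
    rw [hGg, Set.add_singleton]
    exact ⟨by rintro ⟨q, hq, rfl⟩; simpa using hq, fun h => ⟨_, h, by simp⟩⟩
  set a₀ : EProd X Y := pair p₀.fst l₀ with ha₀
  set b₀ : EProd Y W := pair l₀ (p₀.snd - gt p₀.fst) with hb₀
  -- For `a = (z, l₁)` and `b = (l₂, v)` this is the candidate `(z, v + g̃ z)`, which lies in `gph
  -- H` when `a ∈ gph F`, `b ∈ gph G̃` and `l₁ = l₂`.
  set Φ : EProd X Y × EProd Y W → EProd X W :=
    fun x => pair x.1.fst (x.2.snd + gt x.1.fst) with hΦ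
  have hΦ₀ : Φ (a₀, b₀) = p₀ := by
    change pair p₀.fst (p₀.snd - gt p₀.fst + gt p₀.fst) = p₀
    rw [sub_add_cancel]
    rfl
  have hfst : HasFDerivAt (fun x : EProd X Y × EProd Y W => x.1.fst)
      (WithLp.fstL 2 ℝ X Y ∘L .fst ℝ _ _) (a₀, b₀) :=
    (WithLp.fstL 2 ℝ X Y ∘L .fst ℝ (EProd X Y) (EProd Y W)).hasFDerivAt
  have hsnd : HasFDerivAt (fun x : EProd X Y × EProd Y W => x.2.snd)
      (WithLp.sndL 2 ℝ Y W ∘L .snd ℝ _ _) (a₀, b₀) :=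
    (WithLp.sndL 2 ℝ Y W ∘L .snd ℝ (EProd X Y) (EProd Y W)).hasFDerivAt
  have hΦlip : ∃ C : ℝ, 0 < C ∧ ∀ᶠ x in 𝓝 (a₀, b₀), ‖Φ x - p₀‖ ≤ C * ‖x - (a₀, b₀)‖ := by
    have h1 := (hder p₀.fst).isBigO_sub
    obtain ⟨C, hC, h1⟩ := h1.exists_pos
    have h1 := h1.bound
    have ht : Tendsto (fun x : EProd X Y × EProd Y W => x.1.fst) (𝓝 (a₀, b₀)) (𝓝 p₀.fst) :=
      hfst.continuousAt
    refine ⟨2 + C, by positivity, (ht.eventually h1).mono fun x hx => ?_⟩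
    have n1 : ‖x.1.fst - p₀.fst‖ ≤ ‖x - (a₀, b₀)‖ :=
      (WithLp.norm_fst_le (p := 2) _ (x.1 - a₀)).trans (norm_fst_le (x - (a₀, b₀)))
    have n2 : ‖x.2.snd - (p₀.snd - gt p₀.fst)‖ ≤ ‖x - (a₀, b₀)‖ :=
      (WithLp.norm_snd_le (p := 2) _ (x.2 - b₀)).trans (norm_snd_le (x - (a₀, b₀)))
    have n3 : ‖Φ x - p₀‖ ≤ ‖x.1.fst - p₀.fst‖ + ‖x.2.snd + gt x.1.fst - p₀.snd‖ := by
      refine abs_le_of_sq_le_sq' ?_ (by positivity) |>.2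
      rw [WithLp.prod_norm_sq_eq_of_L2]
      simp only [hΦ, WithLp.sub_fst, WithLp.sub_snd, WithLp.toLp_fst, WithLp.toLp_snd]
      nlinarith [mul_nonneg (norm_nonneg (x.1.fst - p₀.fst))
        (norm_nonneg (x.2.snd + gt x.1.fst - p₀.snd))]
    have n4 : ‖x.2.snd + gt x.1.fst - p₀.snd‖ ≤
        ‖x.2.snd - (p₀.snd - gt p₀.fst)‖ + ‖gt x.1.fst - gt p₀.fst‖ := by
      refine le_trans (le_of_eq ?_) (norm_add_le _ _)
      congr 1
      abel
    nlinarith [mul_le_mul_of_nonneg_left n1 hC.le]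
  obtain ⟨C, hC, hlip⟩ := hΦlip
  -- The bound `ε₁ ≤ 1` keeps the penalty constant `(1 + ‖ζ‖) * κ` independent of `ε`; the other
  -- bound absorbs the local Lipschitz constant `C` of `Φ`.
  set ε₁ := min 1 (ε / (2 * C)) with hε₁def
  have hε₁ : 0 < ε₁ := lt_min one_pos (by positivity)
  have hε₁C : ε₁ * C ≤ ε / 2 := by
    refine (mul_le_mul_of_nonneg_right (min_le_right _ _) hC.le).trans (le_of_eq ?_)
    field_simp
  obtain ⟨r, hr, hball⟩ := Metric.eventually_nhds_iff.1
    (eventually_inner_le_of_mem_regularNormalCone hζ hε₁)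
  set A₁ := WithLp.sndL 2 ℝ X Y
  set A₂ := WithLp.fstL 2 ℝ Y W
  have hΦc : ContinuousAt Φ (a₀, b₀) :=
    tendsto_pair hfst.continuousAt (hsnd.continuousAt.add
      ((hder p₀.fst).continuousAt.comp (f := fun x : EProd X Y × EProd Y W => x.1.fst)
        (x := (a₀, b₀)) hfst.continuousAt))
  have hev₁ : ∀ᶠ x in 𝓝 (a₀, b₀), ‖Φ x - p₀‖ < r / 2 := by
    have : Tendsto (fun x => ‖Φ x - p₀‖) (𝓝 (a₀, b₀)) (𝓝 0) := by
      have := (hΦc.tendsto.sub_const p₀).norm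
      rwa [hΦ₀, sub_self, norm_zero] at this
    exact this.eventually_lt_const (by positivity)
  have hev₂ : ∀ᶠ x : EProd X Y × EProd Y W in 𝓝 (a₀, b₀), κ * ‖A₁ x.1 - A₂ x.2‖ < r / 2 := by
    have hc : Continuous fun x : EProd X Y × EProd Y W => κ * ‖A₁ x.1 - A₂ x.2‖ := by fun_prop
    have := hc.tendsto (a₀, b₀)
    refine this.eventually_lt_const ?_
    change κ * ‖l₀ - l₀‖ < r / 2
    simp [hr]
  have hev₃ : ∀ᶠ x : EProd X Y × EProd Y W in 𝓝 (a₀, b₀),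
      pair x.1.fst (pair (x.2.snd + gt x.1.fst) x.2.fst) ∈ U := by
    have t1 : Tendsto (fun x : EProd X Y × EProd Y W => x.2.fst) (𝓝 (a₀, b₀)) (𝓝 l₀) :=
      (A₂.continuous.comp continuous_snd).tendsto (a₀, b₀)
    have t2 := hΦc.tendsto
    rw [hΦ₀] at t2
    exact (tendsto_pair (tendsto_fst' t2) (tendsto_pair (tendsto_snd' t2) t1)).eventually hU
  -- Separability of `G` enters here: `⟪ζ, Φ (a, b)⟫` is a function of `a` plus a function of `b`.
  have hψ₁ : ∀ a : EProd X Y, HasFDerivAt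
      (fun a : EProd X Y => inner ℝ ζ.fst a.fst + inner ℝ ζ.snd (gt a.fst))
      (innerSL ℝ (pair (ζ.fst + ContinuousLinearMap.adjoint (fderiv ℝ gt a.fst) ζ.snd)
        (0 : Y))) a := by
    intro a
    have h := (((innerSL ℝ ζ.fst).hasFDerivAt).comp a (hasFDerivAt_fst' a)).add
      (((innerSL ℝ ζ.snd).hasFDerivAt).comp a ((hder a.fst).comp a (hasFDerivAt_fst' a)))
    refine h.congr_fderiv ?_
    ext v
    simp [WithLp.prod_inner_apply, inner_add_left, ContinuousLinearMap.adjoint_inner_left]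
  have hψ₂ : ∀ b : EProd Y W, HasFDerivAt (fun b : EProd Y W => inner ℝ ζ.snd b.snd)
      (innerSL ℝ (pair (0 : Y) ζ.snd)) b := by
    intro b
    refine (((innerSL ℝ ζ.snd).hasFDerivAt).comp b (hasFDerivAt_snd' b)).congr_fderiv ?_
    ext v
    simp [WithLp.prod_inner_apply]
  obtain ⟨a, ha, b, hb, har, hbr, μ, e₁, e₂, hμ, he₁, he₂, hn₁, hn₂⟩ :=
    exists_decoupled_normals hF hGt A₁ A₂ hψ₁ hψ₂ (a₀ := a₀) (b₀ := b₀) hl₀ (hGmem.1 hp₀) rfl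
      (ε := ε / 2) (L := (1 + ‖ζ‖) * κ) (by positivity) (by positivity) hρ (by
    filter_upwards [hlip, hev₁, hev₂, hev₃] with x hx₁ hx₂ hx₃ hx₄ hxF hxG
    -- The regular normal inequality holds only on `gph H`, so `Φ x` is replaced by a nearby `y ∈
    -- gph H`, at a cost proportional to `‖l₁ - l₂‖`.
    obtain ⟨y, hy, hyd⟩ := hbound x.1.fst (x.2.snd + gt x.1.fst) x.1.snd x.2.fst hx₄ hxF
      (hGmem.2 (by rw [add_sub_cancel_right]; exact hxG))
    change ‖y - Φ x‖ ≤ κ * ‖A₁ x.1 - A₂ x.2‖ at hyd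
    have hyr : dist y p₀ < r := by
      rw [dist_eq_norm]
      calc ‖y - p₀‖ ≤ ‖y - Φ x‖ + ‖Φ x - p₀‖ := norm_sub_le_norm_sub_add_norm_sub _ _ _
        _ < r := by linarith
    have hfre := hball hyr hy
    have htri : ‖y - p₀‖ ≤ ‖y - Φ x‖ + ‖Φ x - p₀‖ := norm_sub_le_norm_sub_add_norm_sub _ _ _
    have hval : inner ℝ ζ.fst x.1.fst + inner ℝ ζ.snd (gt x.1.fst) -
        (inner ℝ ζ.fst a₀.fst + inner ℝ ζ.snd (gt a₀.fst)) +
        (inner ℝ ζ.snd x.2.snd - inner ℝ ζ.snd b₀.snd) = inner ℝ ζ (Φ x - p₀) := by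
      simp [WithLp.prod_inner_apply, hΦ, ha₀, hb₀, inner_sub_right, inner_add_right]
      ring
    have hsplit : inner ℝ ζ (Φ x - p₀) = inner ℝ ζ (y - p₀) + inner ℝ ζ (Φ x - y) := by
      rw [← inner_add_right]
      congr 1
      abel
    have hcs : inner ℝ ζ (Φ x - y) ≤ ‖ζ‖ * ‖y - Φ x‖ := by
      rw [norm_sub_rev]
      exact real_inner_le_norm _ _
    have hxsum : ‖x - (a₀, b₀)‖ ≤ ‖x.1 - a₀‖ + ‖x.2 - b₀‖ := by
      rw [Prod.norm_def]
      exact max_le_add_of_nonneg (norm_nonneg _) (norm_nonneg _)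
    rw [hval, hsplit]
    have i1 : ε₁ * ‖y - Φ x‖ ≤ 1 * ‖y - Φ x‖ :=
      mul_le_mul_of_nonneg_right (min_le_left _ _) (norm_nonneg _)
    have i2 : ε₁ * ‖Φ x - p₀‖ ≤ ε / 2 * (‖x.1 - a₀‖ + ‖x.2 - b₀‖) :=
      calc ε₁ * ‖Φ x - p₀‖ ≤ ε₁ * (C * ‖x - (a₀, b₀)‖) := by gcongr
        _ = ε₁ * C * ‖x - (a₀, b₀)‖ := by ring
        _ ≤ _ := by gcongr
    have i3 : (1 + ‖ζ‖) * ‖y - Φ x‖ ≤ (1 + ‖ζ‖) * (κ * ‖A₁ x.1 - A₂ x.2‖) := by gcongr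
    have i4 : ε₁ * ‖y - p₀‖ ≤ ε₁ * (‖y - Φ x‖ + ‖Φ x - p₀‖) := by gcongr
    linarith)
  refine ⟨a, ha, b, hb, har, hbr, μ, e₁, e₂, hμ, by linarith, by linarith,
    fun d hd => ?_, fun d hd => ?_⟩
  · refine le_trans (le_of_eq ?_) (hn₁ d hd)
    rw [inner_sub_left, inner_pair d _ (-μ), inner_pair d _ (0 : Y), inner_neg_left, inner_zero_left]
    change _ + -(inner ℝ μ d.snd) - _ = _ + 0 - inner ℝ μ d.snd - _
    ring
  · refine le_trans (le_of_eq ?_) (hn₂ d hd)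
    rw [inner_sub_left, inner_pair d μ, inner_pair d (0 : Y), inner_zero_left]
    change inner ℝ μ d.fst + _ - _ = 0 + _ + inner ℝ μ d.fst - _
    ring

/-- Subregularity is used only at the limit `λ̄`: its constant and neighborhood serve all late terms
of the sequence, which bounds the multipliers uniformly. -/
theorem exists_normals_of_separable (hF : IsClosed (gph F)) (hG : IsClosed (gph (joint G)))
    {zbar : X} (hK : InnerSemicompactAt (mapKhat F G) (sdom (mapKhat F G)) (pair zbar 0))
    (hGt : IsClosed (gph Gt)) (hgt : ContDiff ℝ 1 gt) (hGg : ∀ z l, G z l = Gt l + {gt z})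
    (hsub : ∀ l ∈ mapK F G zbar,
      MetricallySubregularAt (mapHhat F G) (pair zbar (pair 0 l)) (pair 0 0))
    {ξ : X} {ν : W} (hξ : ξ ∈ coderivative (mapH F G) zbar 0 ν) :
    ∃ lbar ∈ mapK F G zbar, ∃ μ ∈ coderivative Gt lbar (-gt zbar) ν,
      ξ - ContinuousLinearMap.adjoint (fderiv ℝ gt zbar) ν ∈ coderivative F zbar lbar μ := by
  obtain ⟨lbar, hlbar, p, η, l, hmem, hp, hη, hl, hreg⟩ := exists_lifted_sequence hF hG hK hξ
  obtain ⟨κ, hκ, U, hU, hbound⟩ := (hsub lbar hlbar).exists_error_bound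
  have hz : Tendsto (fun k => (p k).fst) atTop (𝓝 zbar) := tendsto_fst' hp
  have hw : Tendsto (fun k => (p k).snd) atTop (𝓝 0) := tendsto_snd' hp
  have hη₁ : Tendsto (fun k => (η k).fst) atTop (𝓝 ξ) := tendsto_fst' hη
  have hη₂ : Tendsto (fun k => (η k).snd) atTop (𝓝 (-ν)) := tendsto_snd' hη
  have hx : Tendsto (fun k => pair (p k).fst (pair (p k).snd (l k))) atTop
      (𝓝 (pair zbar (pair 0 lbar))) := tendsto_pair hz (tendsto_pair hw hl)
  -- From index `N` on, `U` is a neighborhood of the base point itself, as `exists_approx_normals`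
  -- requires.
  obtain ⟨N, hN⟩ := eventually_atTop.1 (hx.eventually (eventually_mem_nhds_iff.2 hU))
  have happ := fun k : ℕ => exists_approx_normals hF hGt hgt hGg hκ (hN (k + N) (by omega)) hbound
    (hmem (k + N)).1 (hmem (k + N)).2 (hreg (k + N)) (ε := 1 / ((k : ℝ) + 1))
    (ρ := 1 / ((k : ℝ) + 1)) (by positivity) (by positivity)
  choose a ha b hb har hbr μ e₁ e₂ hμ he₁ he₂ hn₁ hn₂ using happ
  have hsh : Tendsto (fun k : ℕ => k + N) atTop atTop := tendsto_add_atTop_nat N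
  have hsmall : Tendsto (fun k : ℕ => 1 / ((k : ℝ) + 1)) atTop (𝓝 0) :=
    tendsto_one_div_add_atTop_nhds_zero_nat
  have ha' : Tendsto a atTop (𝓝 (pair zbar lbar)) := by
    have h0 := squeeze_zero_norm har hsmall
    simpa using h0.add ((tendsto_pair hz hl).comp hsh)
  have hb' : Tendsto b atTop (𝓝 (pair lbar (-gt zbar))) := by
    have h0 := squeeze_zero_norm hbr hsmall
    have h1 := (tendsto_pair hl (hw.sub ((hgt.continuous.tendsto zbar).comp hz))).comp hsh
    simpa using h0.add h1
  have he₁' := squeeze_zero_norm he₁ hsmall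
  have he₂' := squeeze_zero_norm he₂ hsmall
  obtain ⟨B, hB⟩ := hη.norm.bddAbove_range
  have hμB : ∀ k, μ k ∈ Metric.closedBall (0 : Y) ((1 + B) * κ) := fun k => by
    rw [mem_closedBall_zero_iff]
    refine (hμ k).trans ?_
    have : ‖η (k + N)‖ ≤ B := hB ⟨_, rfl⟩
    gcongr
  obtain ⟨μbar, -, φ, hφ, hμφ⟩ := tendsto_subseq_of_bounded Metric.isBounded_closedBall hμB
  have hφ' := hφ.tendsto_atTop
  have hη₂' : Tendsto (fun k => (η (φ k + N)).snd) atTop (𝓝 (-ν)) :=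
    hη₂.comp (hsh.comp hφ')
  refine ⟨lbar, hlbar, μbar, ⟨b ∘ φ, _, fun k => hb _, hb'.comp hφ', ?_, fun k => hn₂ (φ k)⟩,
    ⟨a ∘ φ, _, fun k => ha _, ha'.comp hφ', ?_, fun k => hn₁ (φ k)⟩⟩
  · simpa using (tendsto_pair hμφ hη₂').sub (he₂'.comp hφ')
  · have hD : Tendsto (fun k => fderiv ℝ gt (a (φ k)).fst) atTop (𝓝 (fderiv ℝ gt zbar)) :=
      ((hgt.continuous_fderiv one_ne_zero).tendsto _).comp (tendsto_fst' (ha'.comp hφ'))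
    have hA := tendsto_clm_apply (tendsto_adjoint hD) hη₂'
    have h1 : Tendsto (fun k => (η (φ k + N)).fst) atTop (𝓝 ξ) := hη₁.comp (hsh.comp hφ')
    simpa [sub_eq_add_neg] using (tendsto_pair (h1.add hA) hμφ.neg).sub (he₁'.comp hφ')

/-- The coderivative of `G̃` yields elements of the coderivative of `(z, λ) ↦ G̃ λ + g̃ z`. -/
theorem mem_coderivative_joint_of_separable (hgt : ContDiff ℝ 1 gt)
    (hGg : ∀ z l, G z l = Gt l + {gt z}) {zbar : X} {lbar μ : Y} {ν : W}
    (hμ : μ ∈ coderivative Gt lbar (-gt zbar) ν) :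
    pair (ContinuousLinearMap.adjoint (fderiv ℝ gt zbar) ν) μ ∈
      coderivative (joint G) (pair zbar lbar) 0 ν := by
  obtain ⟨b, η, hb, hblim, hη, hreg⟩ := hμ
  have hη₁ : Tendsto (fun k => (η k).fst) atTop (𝓝 μ) := tendsto_fst' hη
  have hη₂ : Tendsto (fun k => (η k).snd) atTop (𝓝 (-ν)) := tendsto_snd' hη
  have hder : HasFDerivAt gt (fderiv ℝ gt zbar) zbar :=
    (hgt.differentiable one_ne_zero zbar).hasFDerivAt
  refine ⟨fun k => pair (pair zbar (b k).fst) ((b k).snd + gt zbar), fun k => pair (pair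
    (ContinuousLinearMap.adjoint (fderiv ℝ gt zbar) (-(η k).snd)) (η k).fst) (η k).snd,
    fun k => ?_, ?_, ?_, fun k => ?_⟩
  · change _ ∈ G zbar (b k).fst
    rw [hGg, Set.add_singleton]
    exact ⟨_, hb k, rfl⟩
  · refine tendsto_pair (tendsto_pair tendsto_const_nhds (tendsto_fst' hblim)) ?_
    simpa using (tendsto_snd' hblim).add_const (gt zbar)
  · refine tendsto_pair (tendsto_pair ?_ hη₁) hη₂
    have := ((ContinuousLinearMap.continuous
      (ContinuousLinearMap.adjoint (fderiv ℝ gt zbar))).tendsto _).comp hη₂.neg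
    rwa [neg_neg] at this
  · set q₀ : EProd (EProd X Y) W := pair (pair zbar (b k).fst) ((b k).snd + gt zbar)
    have h₁ : HasFDerivAt (fun q : EProd (EProd X Y) W => q.fst.snd)
        (WithLp.sndL 2 ℝ X Y ∘L WithLp.fstL 2 ℝ (EProd X Y) W) q₀ :=
      (WithLp.sndL 2 ℝ X Y ∘L WithLp.fstL 2 ℝ (EProd X Y) W).hasFDerivAt
    have h₂ : HasFDerivAt (fun q : EProd (EProd X Y) W => q.fst.fst)
        (WithLp.fstL 2 ℝ X Y ∘L WithLp.fstL 2 ℝ (EProd X Y) W) q₀ :=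
      (WithLp.fstL 2 ℝ X Y ∘L WithLp.fstL 2 ℝ (EProd X Y) W).hasFDerivAt
    have h₃ : HasFDerivAt (fun q : EProd (EProd X Y) W => gt q.fst.fst) _ q₀ :=
      HasFDerivAt.comp (g := gt) q₀ hder h₂
    -- The map `((z, λ), w) ↦ (λ, w - g̃ z)` sends `gph G` into `gph G̃`.
    refine mem_regularNormalCone_of_map (B := gph Gt) (ζ := η k) (q := b k)
      (h₁.pair ((hasFDerivAt_snd' q₀).fun_sub h₃)) ?_ ?_ (hreg k) ?_
    · simp only [WithLp.toLp_fst, WithLp.toLp_snd, add_sub_cancel_right]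
      rfl
    · intro q hq
      change q.snd ∈ G q.fst.fst q.fst.snd at hq
      rw [hGg, Set.add_singleton] at hq
      obtain ⟨w, hw, he⟩ := hq
      simp only at he
      change q.snd - gt q.fst.fst ∈ Gt q.fst.snd
      rw [← he]
      simpa using hw
    · intro d
      simp only [pairL_apply, WithLp.prod_inner_apply, ContinuousLinearMap.comp_apply,
        sub_apply]
      simp [ContinuousLinearMap.adjoint_inner_left, inner_sub_right]
      ring

end Separable

theorem zero_mem_add_of_sum_eq_zero {E : Type*} [AddCommGroup E] {A B C D : Set E} {a b c d : E}
    (ha : a ∈ A) (hb : b ∈ B) (hc : c ∈ C) (hd : d ∈ D) (h : a + b + c + d = 0) : 0 ∈ A + B + C + D :=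
  h ▸ Set.add_mem_add (Set.add_mem_add (Set.add_mem_add ha hb) hc) hd

end ImplicitVariables

/-! ### Assembly of the two cases. -/

open ImplicitVariables in
theorem proposition4p17 (n m s : ℕ)
    (f : EuclideanSpace ℝ (Fin n) → ℝ) (hf : LocallyLipschitz f)
    (F : EuclideanSpace ℝ (Fin n) → Set (EuclideanSpace ℝ (Fin m)))
    (hF : IsClosed (gph F))
    (G : EuclideanSpace ℝ (Fin n) → EuclideanSpace ℝ (Fin m) → Set (EuclideanSpace ℝ (Fin s)))
    (hG : IsClosed (gph (joint G)))
    (M : Set (EuclideanSpace ℝ (Fin n))) (hMne : M.Nonempty) (hM : IsClosed M)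
    (hH : IsClosed (gph (mapH F G)))
    (zbar : EuclideanSpace ℝ (Fin n))
    (hstat : IsImplicitlyMStationary f F G M zbar)
    (hK : InnerSemicompactAt (mapKhat F G) (sdom (mapKhat F G)) (pair zbar 0)) :
    (∀ (g : EuclideanSpace ℝ (Fin n) → EuclideanSpace ℝ (Fin m) → EuclideanSpace ℝ (Fin s))
        (Θ : Set (EuclideanSpace ℝ (Fin s))),
      ContDiff ℝ 1 (fun p : EuclideanSpace ℝ (Fin n) × EuclideanSpace ℝ (Fin m) => g p.1 p.2) →
      IsClosed Θ →
      (∀ z l, G z l = {g z l} - Θ) →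
      ∃ lbar ∈ mapK F G zbar,
        IsExplicitlyMStationaryWrt f F G M zbar lbar ∧
        ∃ ν ∈ normalCone Θ (g zbar lbar),
          0 ∈ subdifferential f zbar
            + coderivative F zbar lbar
                (ContinuousLinearMap.adjoint (fderiv ℝ (fun l => g zbar l) lbar) ν)
            + {ContinuousLinearMap.adjoint (fderiv ℝ (fun z => g z lbar) zbar) ν}
            + normalCone M zbar) ∧
    (∀ (Gt : EuclideanSpace ℝ (Fin m) → Set (EuclideanSpace ℝ (Fin s)))
        (gt : EuclideanSpace ℝ (Fin n) → EuclideanSpace ℝ (Fin s)),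
      IsClosed (gph Gt) →
      ContDiff ℝ 1 gt →
      (∀ z l, G z l = Gt l + {gt z}) →
      (∀ l ∈ mapK F G zbar,
        MetricallySubregularAt (mapHhat F G) (pair zbar (pair 0 l)) (pair 0 0)) →
      ∃ lbar ∈ mapK F G zbar,
        IsExplicitlyMStationaryWrt f F G M zbar lbar ∧
        ∃ ν : EuclideanSpace ℝ (Fin s),
          0 ∈ subdifferential f zbar
            + scomp (coderivative F zbar lbar) (coderivative Gt lbar (-gt zbar)) ν
            + {ContinuousLinearMap.adjoint (fderiv ℝ gt zbar) ν}
            + normalCone M zbar) := by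
  obtain ⟨hfeas, ν, _, ⟨α, hα, ξ, hξ, rfl⟩, γ, hγ, hsum⟩ := hstat
  simp only at hsum
  constructor
  · intro g Θ hg _ hGg
    obtain ⟨lbar, hlbar, hν, hcod⟩ := exists_normals_of_smooth_sub_set hF hG hK hg hGg hξ
    -- The coderivative element `ξ` is split into an element for `F` and the gradient term; the same
    -- splitting proves both stationarity systems.
    have hzero : α + (ξ - ContinuousLinearMap.adjoint (fderiv ℝ (fun z => g z lbar) zbar) ν) +
        ContinuousLinearMap.adjoint (fderiv ℝ (fun z => g z lbar) zbar) ν + γ = 0 := by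
      rw [← hsum]; abel
    exact ⟨lbar, hlbar, ⟨hfeas, hlbar, _, ν, zero_mem_add_of_sum_eq_zero hα hcod
      (mem_coderivative_joint_of_smooth_sub_set hg hGg hν) hγ hzero⟩, ν, hν,
      zero_mem_add_of_sum_eq_zero hα hcod rfl hγ hzero⟩
  · intro Gt gt hGt hgt hGg hsub
    obtain ⟨lbar, hlbar, μ, hμ, hcod⟩ :=
      exists_normals_of_separable hF hG hK hGt hgt hGg hsub hξ
    have hzero : α + (ξ - ContinuousLinearMap.adjoint (fderiv ℝ gt zbar) ν) +
        ContinuousLinearMap.adjoint (fderiv ℝ gt zbar) ν + γ = 0 := by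
      rw [← hsum]; abel
    exact ⟨lbar, hlbar, ⟨hfeas, hlbar, μ, ν, zero_mem_add_of_sum_eq_zero hα hcod
      (mem_coderivative_joint_of_separable hgt hGg hμ) hγ hzero⟩, ν,
      zero_mem_add_of_sum_eq_zero hα (Set.mem_biUnion hμ hcod) rfl hγ hzero⟩
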